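/- A *P-space* is a completely regular $T_1$ space in which every countable intersection of open sets is open. A space is *rigid* if the identity is its only homeomorphism onto itself. The *weight* of a space is the least cardinality of a base. Let $\mathfrak c = 2^{\aleph_0}$. (1) There are at least $\mathfrak c$ many pairwise non-homeomorphic rigid Lindelöf P-spaces of cardinality $\omega_1$ and weight $\omega_1$. (2) More precisely, there exists a rigid Lindelöf P-space of cardinality and weight $\omega_1$ (a theorem of Kunen), and for every such space $X$ there is a sequence $(U_n)_{n<\omega}$ of nonempty, pairwise disjoint clopen subsets of $X$ such that the subspaces $X_A=\bigcup_{n\in A}U_n$, for $A\subseteq\omega$, have the following properties: every $X_A$ is clopen in $X$; if $A\neq\emptyset$, then $X_A$ is a rigid Lindelöf P-space of cardinality and weight $\omega_1$; and if $A\neq B$, then $X_A$ and $X_B$ are not homeomorphic. -/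

import Mathlib

open Cardinal Topology

universe u

/-- A P-space: a completely regular `T₁` space in which every countable intersection of open sets
is open. -/
structure IsPSpace (X : Type u) [TopologicalSpace X] : Prop where
  completelyRegular : T35Space X
  isOpen_of_isGδ : ∀ s : Set X, IsGδ s → IsOpen s

/-- A space is rigid if the identity is its only homeomorphism onto itself. -/
def IsRigidSpace (X : Type u) [TopologicalSpace X] : Prop :=
  ∀ f : X ≃ₜ X, f = Homeomorph.refl X

/-- The weight of a topological space: the least cardinality of a base. -/
noncomputable def topWeight (X : Type u) [TopologicalSpace X] : Cardinal.{u} :=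
  sInf {κ : Cardinal.{u} | ∃ B : Set (Set X), TopologicalSpace.IsTopologicalBasis B ∧ #B = κ}

/-- Rigid Lindelöf P-spaces of cardinality and weight `ω₁`. -/
structure IsRigidLindelofPSpaceOmegaOne (X : Type u) [TopologicalSpace X] : Prop where
  isPSpace : IsPSpace X
  lindelof : LindelofSpace X
  rigid : IsRigidSpace X
  card_eq : #X = ℵ₁
  weight_eq : topWeight X = ℵ₁

/-!
The statement rests on Kunen's theorem and on an exchange argument.

*Exchange* (`IsRigidSpace.coe_apply_eq`). P-spaces are zero-dimensional. A homeomorphism between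
clopen subspaces `A` and `B` of a rigid P-space that moved a point would carry a nonempty clopen
set onto a disjoint clopen set, and exchanging those two sets would be a nontrivial
autohomeomorphism of the whole space. So it moves no point: clopen subspaces are rigid, and
different clopen subspaces are not homeomorphic. A rigid P-space has at most one isolated point,
and nonempty open sets containing other points are uncountable. Hence any disjoint clopen
neighbourhoods `U n` of countably many non-isolated points have the required properties; unions of
countably many clopen sets are clopen because the space is a P-space.

*Existence* (`exists_isRigidLindelofPSpaceOmegaOne`). The points of the space are subsets of `ω₁`,
and the basic neighbourhoods of a point are given by its initial segments, so that the space is the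
space of cofinal branches of a tree of height `ω₁`. The points are the sets `E γ ∪ F` with `F`
finite and above `γ`, for a family of sets `E γ ⊆ γ`. Split `ω₁` into `ℵ₁` many stationary sets
(`IsStationary.exists_fibres`), one for each node `E δ ∪ F` of a height `β` and one more. If `γ > β`
lies in the stationary set of such a node, `E γ` is that node with a set of type at most `ω` cofinal
in `γ` added on top; otherwise `E γ` is empty. Then the levels of the tree are countable, and at a
limit height `α` the only node that need not be a point bounded below `α` is `E α`.

The space is Lindelöf (`LadderSpace.lindelofSpace`): given an open cover, the stationary set left
over provides an `α` with `E α = ∅` closed under the heights of chosen neighbourhoods, and the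
neighbourhoods of the countably many points bounded below `α` cover everything. It is rigid
(`LadderSpace.isRigidSpace`): an autohomeomorphism respects, for closed unboundedly many `α`, the
distinction between the nodes of height `α` that are points bounded below `α` and those that are
not. The heights `α` at which a node of the second kind occurs in a given basic open set of height
`β` include all limit `α > β` in the stationary set attached to that set, and for such `α` the only
such node, `E α`, lies in that basic open set. So no nonempty open set can be carried to a set
disjoint from it.
-/

/-! ### P-spaces -/

namespace IsPSpace

variable {X : Type u} [TopologicalSpace X]

theorem t1Space (hX : IsPSpace X) : T1Space X :=
  have := hX.completelyRegular
  inferInstance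

theorem isClosed_iUnion (hX : IsPSpace X) {ι : Type*} [Countable ι] {s : ι → Set X}
    (hs : ∀ i, IsClosed (s i)) : IsClosed (⋃ i, s i) := by
  rw [← isOpen_compl_iff, Set.compl_iUnion]
  exact hX.isOpen_of_isGδ _ (.iInter_of_isOpen fun i => (hs i).isOpen_compl)

theorem isClopen_iUnion (hX : IsPSpace X) {ι : Type*} [Countable ι] {s : ι → Set X}
    (hs : ∀ i, IsClopen (s i)) : IsClopen (⋃ i, s i) :=
  ⟨hX.isClosed_iUnion fun i => (hs i).1, isOpen_iUnion fun i => (hs i).2⟩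

theorem isClopen_iInter (hX : IsPSpace X) {ι : Type*} [Countable ι] {s : ι → Set X}
    (hs : ∀ i, IsClopen (s i)) : IsClopen (⋂ i, s i) :=
  ⟨isClosed_iInter fun i => (hs i).1,
    hX.isOpen_of_isGδ _ (.iInter_of_isOpen fun i => (hs i).2)⟩

theorem isClosed_of_countable (hX : IsPSpace X) {s : Set X} (hs : s.Countable) :
    IsClosed s := by
  have := hX.t1Space
  have := hs.to_subtype
  rw [← Set.iUnion_of_singleton_coe s]
  exact hX.isClosed_iUnion fun i => isClosed_singleton

/-- P-spaces are zero-dimensional: the zero set of a continuous function is a `Gδ`. -/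
theorem exists_isClopen (hX : IsPSpace X) {x : X} {U : Set X} (hU : IsOpen U) (hx : x ∈ U) :
    ∃ V, IsClopen V ∧ x ∈ V ∧ V ⊆ U := by
  have := hX.completelyRegular
  obtain ⟨f, hf, hfx, hfU⟩ := CompletelyRegularSpace.completely_regular x Uᶜ
    hU.isClosed_compl (by simpa using hx)
  refine ⟨f ⁻¹' {0}, ⟨isClosed_singleton.preimage hf,
    hX.isOpen_of_isGδ _ ((IsGδ.singleton (0 : unitInterval)).preimage hf)⟩, hfx, fun y hy => ?_⟩
  by_contra hyU
  have h1 : f y = 1 := hfU hyU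
  have h0 : f y = 0 := hy
  exact zero_ne_one (h0.symm.trans h1)

theorem subtype (hX : IsPSpace X) (A : Set X) : IsPSpace A := by
  have := hX.completelyRegular
  refine ⟨inferInstance, fun s hs => ?_⟩
  obtain ⟨f, hf, rfl⟩ := isGδ_iff_eq_iInter_nat.1 hs
  choose g hg hgf using fun n => isOpen_induced_iff.1 (hf n)
  refine isOpen_induced_iff.2 ⟨⋂ n, g n, hX.isOpen_of_isGδ _ (.iInter_of_isOpen hg), ?_⟩
  simp [Set.preimage_iInter, hgf]

/-- An uncountable P-space has uncountable weight, since a point with a countable neighbourhood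
base is isolated. -/
theorem aleph_one_le_topWeight (hX : IsPSpace X) (hc : ℵ₁ ≤ #X) : ℵ₁ ≤ topWeight X := by
  have := hX.t1Space
  obtain ⟨B, hB, hBc⟩ : topWeight X ∈
      {κ | ∃ B : Set (Set X), TopologicalSpace.IsTopologicalBasis B ∧ #B = κ} :=
    csInf_mem ⟨_, _, TopologicalSpace.isTopologicalBasis_opens, rfl⟩
  rw [← hBc]
  by_contra hlt
  have hBcount : B.Countable := by
    rwa [not_le, lt_aleph_one_iff, le_aleph0_iff_set_countable] at hlt
  have hmem (x : X) : ({x} : Set X) ∈ B := by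
    have hx : IsOpen ({x} : Set X) := by
      have : ({x} : Set X) = ⋂₀ {b ∈ B | x ∈ b} := by
        ext y
        refine ⟨fun h b hb => h ▸ hb.2, fun h => ?_⟩
        by_contra hne
        obtain ⟨b, hb, hxb, hbs⟩ := hB.exists_subset_of_mem_open
          (show x ∈ ({y} : Set X)ᶜ from fun h => hne h.symm) isOpen_compl_singleton
        exact hbs (h b ⟨hb, hxb⟩) rfl
      rw [this]
      exact hX.isOpen_of_isGδ _ (.sInter (fun b hb => (hB.isOpen hb.1).isGδ)
        (hBcount.mono fun _ h => h.1))
    obtain ⟨b, hb, hxb, hbs⟩ := hB.exists_subset_of_mem_open (Set.mem_singleton x) hx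
    rwa [← hbs.antisymm (Set.singleton_subset_iff.2 hxb)]
  have : #X ≤ #B := mk_le_of_injective (f := fun x => (⟨{x}, hmem x⟩ : B)) fun x y h => by
    simpa using h
  exact hlt (hc.trans this)

/-- A neighbourhood of a non-isolated point of a P-space is uncountable, because countable sets are
closed. -/
theorem not_countable_of_isOpen (hX : IsPSpace X) {U : Set X} (hU : IsOpen U) {x : X}
    (hx : x ∈ U) (hiso : ¬ IsOpen ({x} : Set X)) : ¬ U.Countable := fun hc => by
  refine hiso ?_
  have : ({x} : Set X) = U \ (U \ {x}) := by
    rw [Set.sdiff_sdiff_right_self, Set.inter_eq_right.2 (Set.singleton_subset_iff.2 hx)]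
  rw [this]
  exact hU.sdiff (hX.isClosed_of_countable (hc.mono Set.sdiff_subset))

/-- Countably many distinct points of a P-space have pairwise disjoint clopen neighbourhoods. -/
theorem exists_disjoint_isClopen (hX : IsPSpace X) (x : ℕ → X) (hx : Function.Injective x) :
    ∃ U : ℕ → Set X, (∀ n, IsClopen (U n)) ∧ (∀ n, x n ∈ U n) ∧
      ∀ m n, m ≠ n → Disjoint (U m) (U n) := by
  have := hX.t1Space
  have hex (n : ℕ) : ∃ V, IsClopen V ∧ x n ∈ V ∧ V ⊆ (x '' {n}ᶜ)ᶜ :=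
    hX.exists_isClopen (hX.isClosed_of_countable ((Set.to_countable _).image x)).isOpen_compl
      (by rintro ⟨m, hm, h⟩; exact hm (hx h))
  choose V hV hxV hVs using hex
  refine ⟨fun n => V n ∩ ⋂ m : Set.Iio n, (V m)ᶜ, fun n => (hV n).inter
    (hX.isClopen_iInter fun m => (hV m).compl), fun n => ⟨hxV n, ?_⟩, fun m n hmn => ?_⟩
  · simp only [Set.mem_iInter, Set.mem_compl_iff]
    exact fun m hm => hVs m hm ⟨n, (ne_of_lt m.2).symm, rfl⟩
  · rw [Set.disjoint_left]
    rintro y ⟨hm, hm'⟩ ⟨hn, hn'⟩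
    simp only [Set.mem_iInter, Set.mem_compl_iff, Subtype.forall, Set.mem_Iio] at hm' hn'
    exact hmn.lt_or_gt.elim (fun h => hn' m h hm) (fun h => hm' n h hn)

end IsPSpace

theorem topWeight_subtype_le {X : Type u} [TopologicalSpace X] (A : Set X) :
    topWeight A ≤ topWeight X := by
  obtain ⟨B, hB, hBc⟩ : topWeight X ∈
      {κ | ∃ B : Set (Set X), TopologicalSpace.IsTopologicalBasis B ∧ #B = κ} :=
    csInf_mem ⟨_, _, TopologicalSpace.isTopologicalBasis_opens, rfl⟩
  rw [← hBc]
  exact (csInf_le' ⟨_, hB.isInducing Topology.IsInducing.subtypeVal, rfl⟩ :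
    topWeight A ≤ #(Set.preimage Subtype.val '' B)).trans mk_image_le

/-! ### Clopen subspaces of rigid P-spaces -/

/-- A homeomorphism between clopen subspaces of a rigid P-space moves no point: otherwise it maps
some nonempty clopen set to a disjoint one, and exchanging the two is a nontrivial
autohomeomorphism of the whole space. -/
theorem IsRigidSpace.coe_apply_eq {X : Type u} [TopologicalSpace X] (hr : IsRigidSpace X)
    (hX : IsPSpace X) {A B : Set X} (hA : IsClopen A) (hB : IsClopen B) (h : A ≃ₜ B) (a : A) :
    (h a : X) = a := by
  classical
  by_contra hne
  have := hX.t1Space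
  obtain ⟨W, hW, haW, hWs⟩ := hX.exists_isClopen (isOpen_compl_singleton (x := (h a : X)))
    (show (a : X) ∈ _ from fun e => hne e.symm)
  replace hWs : (h a : X) ∉ W := fun hm => hWs hm rfl
  -- `f` and `g` extend `h` and its inverse by the identity
  let f : X → X := fun x => if hx : x ∈ A then h ⟨x, hx⟩ else x
  let g : X → X := fun x => if hx : x ∈ B then h.symm ⟨x, hx⟩ else x
  have hf (x : A) : f x = h x := by simp [f]
  have hg (x : B) : g x = h.symm x := by simp [g]
  have hfc : ContinuousOn f A := by
    rw [continuousOn_iff_continuous_domRestrict]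
    exact (continuous_subtype_val.comp h.continuous).congr fun x => (hf x).symm
  have hgc : ContinuousOn g B := by
    rw [continuousOn_iff_continuous_domRestrict]
    exact (continuous_subtype_val.comp h.symm.continuous).congr fun x => (hg x).symm
  have hfA : Set.MapsTo f A B := fun x hx => by rw [hf ⟨x, hx⟩]; exact (h _).2
  have hgB : Set.MapsTo g B A := fun x hx => by rw [hg ⟨x, hx⟩]; exact (h.symm _).2
  have hgf : ∀ x ∈ A, g (f x) = x := fun x hx => by rw [hf ⟨x, hx⟩, hg]; simp
  have hfg : ∀ x ∈ B, f (g x) = x := fun x hx => by rw [hg ⟨x, hx⟩, hf]; simp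
  have hpre {C D : Set X} {k : X → X} (hk : ContinuousOn k C) (hC : IsClopen C)
      (hD : IsClopen D) : IsClopen (C ∩ k ⁻¹' D) :=
    ⟨hk.preimage_isClosed_of_isClosed hC.1 hD.1, hk.isOpen_inter_preimage hC.2 hD.2⟩
  let U : Set X := A ∩ W ∩ (A ∩ f ⁻¹' Wᶜ)
  let V : Set X := B ∩ g ⁻¹' U
  have hU : IsClopen U := (hA.inter hW).inter (hpre hfc hA hW.compl)
  have hV : IsClopen V := hpre hgc hB hU
  have hUV : Disjoint U V := by
    rw [Set.disjoint_left]
    rintro x hx ⟨hxB, hxV⟩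
    have := hxV.2.2
    rw [Set.mem_preimage, hfg x hxB] at this
    exact this hx.1.2
  have hfU : ∀ x ∈ U, f x ∈ V := fun x hx =>
    ⟨hfA hx.1.1, by rwa [Set.mem_preimage, hgf x hx.1.1]⟩
  let k : X → X := U.piecewise f (V.piecewise g id)
  have hkU : ∀ x ∈ U, k x = f x := fun x hx => by simp [k, hx]
  have hkV : ∀ x ∈ V, k x = g x := fun x hx => by
    simp [k, hx, Set.disjoint_right.1 hUV hx]
  have hkk : Function.Involutive k := fun x => by
    by_cases hxU : x ∈ U
    · rw [hkU x hxU, hkV _ (hfU x hxU), hgf x hxU.1.1]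
    by_cases hxV : x ∈ V
    · rw [hkV x hxV, hkU _ hxV.2, hfg x hxV.1]
    have : k x = x := by simp [k, hxU, hxV]
    rw [this, this]
  have hkc : Continuous k := by
    refine continuous_piecewise (by simp [hU.frontier_eq]) ?_ ?_
    · rw [hU.1.closure_eq]
      exact hfc.mono fun x hx => hx.1.1
    · refine Continuous.continuousOn (continuous_piecewise (by simp [hV.frontier_eq]) ?_
        continuousOn_id)
      rw [hV.1.closure_eq]
      exact hgc.mono fun x hx => hx.1
  have hid := hr ⟨hkk.toPerm, hkc, hkc⟩
  have haU : (a : X) ∈ U := ⟨⟨a.2, haW⟩, a.2, by rwa [Set.mem_preimage, hf]⟩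
  have : k a = a := DFunLike.congr_fun hid (a : X)
  rw [hkU _ haU, hf] at this
  exact hne this

theorem IsRigidSpace.subtype {X : Type u} [TopologicalSpace X] (hr : IsRigidSpace X)
    (hX : IsPSpace X) {A : Set X} (hA : IsClopen A) : IsRigidSpace A := fun h =>
  Homeomorph.ext fun a => Subtype.ext (hr.coe_apply_eq hX hA hA h a)

theorem IsRigidSpace.eq_of_homeomorph {X : Type u} [TopologicalSpace X] (hr : IsRigidSpace X)
    (hX : IsPSpace X) {A B : Set X} (hA : IsClopen A) (hB : IsClopen B) (h : A ≃ₜ B) :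
    A = B := by
  refine Set.Subset.antisymm (fun x hx => ?_) fun x hx => ?_
  · have := hr.coe_apply_eq hX hA hB h ⟨x, hx⟩
    exact (show (h ⟨x, hx⟩ : X) = x from this) ▸ (h ⟨x, hx⟩).2
  · have := hr.coe_apply_eq hX hB hA h.symm ⟨x, hx⟩
    exact (show (h.symm ⟨x, hx⟩ : X) = x from this) ▸ (h.symm ⟨x, hx⟩).2

theorem IsRigidSpace.subsingleton_isolated {X : Type u} [TopologicalSpace X]
    (hr : IsRigidSpace X) (hX : IsPSpace X) :
    {x : X | IsOpen ({x} : Set X)}.Subsingleton := fun x hx y hy => by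
  have := hX.t1Space
  have h : ({x} : Set X) ≃ₜ ({y} : Set X) := Homeomorph.homeomorphOfUnique _ _
  exact Set.singleton_injective (hr.eq_of_homeomorph hX ⟨isClosed_singleton, hx⟩
    ⟨isClosed_singleton, hy⟩ h)

theorem IsRigidLindelofPSpaceOmegaOne.subtype {X : Type u} [TopologicalSpace X]
    (hX : IsRigidLindelofPSpaceOmegaOne X) {A : Set X} (hA : IsClopen A)
    (hc : ¬ A.Countable) : IsRigidLindelofPSpaceOmegaOne A := by
  have hcard : #A = ℵ₁ := by
    refine le_antisymm ((mk_set_le A).trans_eq hX.card_eq) ?_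
    rwa [← le_aleph0_iff_set_countable, ← lt_aleph_one_iff, not_lt] at hc
  have hP := hX.isPSpace.subtype A
  have := hX.lindelof
  exact ⟨hP, isLindelof_iff_lindelofSpace.1 hA.1.isLindelof,
    hX.rigid.subtype hX.isPSpace hA, hcard,
    le_antisymm ((topWeight_subtype_le A).trans_eq hX.weight_eq)
      (hP.aleph_one_le_topWeight hcard.ge)⟩

/-- Any disjoint clopen neighbourhoods of countably many non-isolated points will do. -/
theorem IsRigidLindelofPSpaceOmegaOne.exists_clopen_sequence {X : Type u} [TopologicalSpace X]
    (hX : IsRigidLindelofPSpaceOmegaOne X) :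
    ∃ U : ℕ → Set X,
      (∀ n, IsClopen (U n)) ∧
      (∀ n, (U n).Nonempty) ∧
      (∀ m n, m ≠ n → Disjoint (U m) (U n)) ∧
      (∀ A : Set ℕ, IsClopen (⋃ n ∈ A, U n)) ∧
      (∀ A : Set ℕ, A.Nonempty → IsRigidLindelofPSpaceOmegaOne (⋃ n ∈ A, U n : Set X)) ∧
      (∀ A B : Set ℕ, A ≠ B →
        IsEmpty ((⋃ n ∈ A, U n : Set X) ≃ₜ (⋃ n ∈ B, U n : Set X))) := by
  have hP := hX.isPSpace
  have : Infinite X := by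
    rw [infinite_iff, hX.card_eq]
    exact aleph0_lt_aleph_one.le
  have hinf : {x : X | IsOpen ({x} : Set X)}ᶜ.Infinite :=
    (hX.rigid.subsingleton_isolated hP).finite.infinite_compl
  have := hinf.to_subtype
  let x := Infinite.natEmbedding ({x : X | IsOpen ({x} : Set X)}ᶜ : Set X)
  obtain ⟨U, hU, hxU, hd⟩ := hP.exists_disjoint_isClopen (fun n => (x n : X))
    (Subtype.val_injective.comp x.injective)
  have hclopen (A : Set ℕ) : IsClopen (⋃ n ∈ A, U n) := by
    rw [Set.biUnion_eq_iUnion]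
    exact hP.isClopen_iUnion fun n => hU n
  have hsub {A B : Set ℕ} (h : (⋃ n ∈ A, U n) = ⋃ n ∈ B, U n) : A ⊆ B := fun n hn => by
    have hmem : (x n : X) ∈ ⋃ n ∈ B, U n := h ▸ Set.mem_biUnion hn (hxU n)
    obtain ⟨m, hm, hxm⟩ := Set.mem_iUnion₂.1 hmem
    by_contra hnB
    exact Set.disjoint_left.1 (hd n m fun e => hnB (e ▸ hm)) (hxU n) hxm
  refine ⟨U, hU, fun n => ⟨_, hxU n⟩, hd, hclopen, ?_, fun A B hAB => ⟨fun h => hAB ?_⟩⟩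
  · rintro A ⟨n, hn⟩
    refine hX.subtype (hclopen A) fun hc => ?_
    exact hP.not_countable_of_isOpen (hU n).2 (hxU n) (x n).2
      (hc.mono (Set.subset_biUnion_of_mem hn))
  · have := hX.rigid.eq_of_homeomorph hP (hclopen A) (hclopen B) h
    exact (hsub this).antisymm (hsub this.symm)

/-! ### Stationary subsets of `ω₁` -/

/-- A linear order of type `ω₁`: it is a well-order of cardinality `ℵ₁` whose proper initial
segments are countable. -/
class IsOmegaOne (Ω : Type u) [LinearOrder Ω] : Prop where
  wellFoundedLT : WellFoundedLT Ω
  countable_Iio : ∀ a : Ω, (Set.Iio a).Countable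
  mk_eq : #Ω = ℵ₁

namespace IsOmegaOne

variable {Ω : Type u} [LinearOrder Ω] [IsOmegaOne Ω]

instance (priority := low) : WellFoundedLT Ω := wellFoundedLT

instance (priority := low) : Uncountable Ω := by
  rw [← aleph0_lt_mk_iff, mk_eq]
  exact aleph0_lt_aleph_one

theorem exists_forall_lt {s : Set Ω} (hs : s.Countable) : ∃ b, ∀ a ∈ s, a < b := by
  by_contra! h
  refine Set.not_countable_univ (α := Ω) ((hs.biUnion (t := fun a _ => Set.Iic a)
    fun a _ => ?_).mono fun b _ => ?_)
  · rw [← Set.Iio_insert]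
    exact (countable_Iio a).insert a
  · obtain ⟨a, ha, hba⟩ := h b
    exact Set.mem_biUnion ha hba

/-- The points closed under a given function are unbounded. -/
theorem exists_gt_closed (g : Ω → Ω) (b : Ω) : ∃ α, b < α ∧ ∀ ξ < α, g ξ < α := by
  have hstep (a : Ω) : ∃ a', a < a' ∧ ∀ ξ < a, g ξ < a' := by
    obtain ⟨c, hc⟩ := exists_forall_lt (((countable_Iio a).image g).insert a)
    exact ⟨c, hc a (Set.mem_insert _ _),
      fun ξ hξ => hc _ (Set.mem_insert_of_mem _ ⟨ξ, hξ, rfl⟩)⟩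
  choose s hs hsg using hstep
  let a : ℕ → Ω := fun n => s^[n] b
  have ha (n : ℕ) : a (n + 1) = s (a n) := Function.iterate_succ_apply' s n b
  have hne : {c | ∀ n, a n < c}.Nonempty := by
    obtain ⟨c, hc⟩ := exists_forall_lt (Set.countable_range a)
    exact ⟨c, fun n => hc _ ⟨n, rfl⟩⟩
  refine ⟨wellFounded_lt.min _ hne, wellFounded_lt.min_mem _ hne 0, fun ξ hξ => ?_⟩
  have : ∃ n, ξ ≤ a n := by
    by_contra! h
    exact wellFounded_lt.not_lt_min {c | ∀ n, a n < c} h hξ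
  obtain ⟨n, hn⟩ := this
  refine lt_trans (hsg _ ξ (hn.trans_lt (ha n ▸ hs _) : ξ < a (n + 1))) ?_
  rw [← ha]
  exact wellFounded_lt.min_mem _ hne (n + 2)

/-- A countable initial segment has a cofinal subset all of whose proper initial segments are
finite. -/
theorem exists_cofinal (α : Ω) : ∃ C : Set Ω, (∀ ξ ∈ C, ξ < α) ∧
    (∀ ξ < α, ∃ η ∈ C, ξ ≤ η) ∧ ∀ β < α, (C ∩ Set.Iio β).Finite := by
  rcases (Set.Iio α).eq_empty_or_nonempty with h | h
  · have hlt (ξ : Ω) : ¬ ξ < α := fun hξ => (h ▸ hξ : ξ ∈ (∅ : Set Ω))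
    exact ⟨∅, by simp, fun ξ hξ => (hlt ξ hξ).elim, fun ξ hξ => (hlt ξ hξ).elim⟩
  obtain ⟨a, ha⟩ := (countable_Iio α).exists_eq_range h
  have hmem (n : ℕ) : a n < α := (ha ▸ ⟨n, rfl⟩ : a n ∈ Set.Iio α)
  have hsurj (ξ : Ω) (hξ : ξ < α) : ∃ n, a n = ξ := (ha ▸ hξ : ξ ∈ Set.range a)
  -- the running maxima of an enumeration of the segment
  refine ⟨Set.range (partialSups a), ?_, fun ξ hξ => ?_, fun β hβ => ?_⟩
  · rintro _ ⟨n, rfl⟩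
    obtain ⟨m, -, hm⟩ := exists_partialSups_eq a n
    exact hm ▸ hmem m
  · obtain ⟨n, rfl⟩ := hsurj ξ hξ
    exact ⟨_, ⟨n, rfl⟩, le_partialSups a n⟩
  · obtain ⟨n, rfl⟩ := hsurj β hβ
    refine ((Set.finite_Iio n).image (partialSups a)).subset ?_
    rintro _ ⟨⟨m, rfl⟩, hm⟩
    refine ⟨m, ?_, rfl⟩
    by_contra hnm
    exact (le_partialSups_of_le a (not_lt.1 hnm)).not_gt hm

theorem cof_ne_aleph0 : Order.cof Ω ≠ ℵ₀ := fun h => by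
  obtain ⟨s, hs, hsc⟩ := Order.exists_cof_eq Ω
  obtain ⟨b, hb⟩ := exists_forall_lt (le_aleph0_iff_set_countable.1 (hsc.trans h).le)
  obtain ⟨a, ha, hba⟩ := hs b
  exact (hb a ha).not_ge hba

theorem isClub_closed (g : Ω → Ω) (b : Ω) : IsClub {α | b < α ∧ ∀ ξ < α, g ξ < α} where
  dirSupClosed := by
    intro t ht ⟨a, ha⟩ _ x hx
    refine ⟨(ht ha).1.trans_le (hx.1 ha), fun ξ hξ => ?_⟩
    obtain ⟨c, hc, hξc⟩ := (lt_isLUB_iff hx).1 hξ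
    exact ((ht hc).2 ξ hξc).trans_le (hx.1 hc)
  isCofinal c := by
    obtain ⟨α, hα, hcl⟩ := exists_gt_closed g (max b c)
    exact ⟨α, ⟨(le_max_left _ _).trans_lt hα, hcl⟩, ((le_max_right _ _).trans_lt hα).le⟩

end IsOmegaOne

namespace IsStationary

variable {Ω : Type u} [LinearOrder Ω] [IsOmegaOne Ω]

/-- A stationary set contains arbitrarily large limit points closed under a given map that takes
countable sets as values. -/
theorem exists_closed {S : Set Ω} (hS : IsStationary S) {c : Ω → Set Ω}
    (hc : ∀ ξ, (c ξ).Countable) (β : Ω) :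
    ∃ α ∈ S, β < α ∧ (∀ ξ < α, ∃ η < α, ξ < η) ∧ ∀ ξ < α, ∀ η ∈ c ξ, η < α := by
  choose g hg using fun ξ => IsOmegaOne.exists_forall_lt ((hc ξ).insert ξ)
  obtain ⟨α, hα, hβ, hcl⟩ := hS (IsOmegaOne.isClub_closed g β)
  refine ⟨α, hα, hβ, fun ξ hξ => ⟨g ξ, hcl ξ hξ, hg ξ ξ (by simp)⟩, fun ξ hξ η hη => ?_⟩
  exact (hg ξ η (by simp [hη])).trans (hcl ξ hξ)

theorem mono_of_lt {S T : Set Ω} (hS : IsStationary S) (β : Ω)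
    (h : ∀ γ ∈ S, β < γ → γ ∈ T) : IsStationary T := fun g hg => by
  obtain ⟨α, hα, hg, hβ, -⟩ := hS (hg.inter IsOmegaOne.cof_ne_aleph0
    (IsOmegaOne.isClub_closed id β))
  exact ⟨α, h α hα hβ, hg⟩

theorem of_iUnion {S : ℕ → Set Ω} {β : Ω} (h : ∀ γ, β < γ → ∃ n, γ ∈ S n) :
    ∃ n, IsStationary (S n) := by
  rw [← isStationary_iUnion_iff_of_countable IsOmegaOne.cof_ne_aleph0]
  refine .of_not_isCofinal_compl fun hcof => ?_
  obtain ⟨c, hc⟩ := IsOmegaOne.exists_forall_lt (Set.countable_singleton β)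
  obtain ⟨γ, hγ, hcγ⟩ := hcof c
  exact hγ (Set.mem_iUnion.2 (h γ ((hc β rfl).trans_le hcγ)))

/-- Ulam's theorem: `ω₁` splits into `ℵ₁` many stationary sets, given here as the fibres of a
function. -/
theorem exists_fibres {I : Type u} [Nonempty I] (hI : #I ≤ ℵ₁) :
    ∃ f : Ω → I, ∀ i, IsStationary (f ⁻¹' {i}) := by
  classical
  have hinj (α : Ω) : ∃ e : Ω → ℕ, Set.InjOn e (Set.Iio α) :=
    Set.countable_iff_exists_injOn.1 (IsOmegaOne.countable_Iio α)
  choose e he using hinj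
  let A : ℕ → Ω → Set Ω := fun n ξ => {α | ξ < α ∧ e α ξ = n}
  choose N hN using fun ξ => of_iUnion (S := fun n => A n ξ) (β := ξ)
    fun γ hγ => ⟨e γ ξ, hγ, rfl⟩
  -- some row of the Ulam matrix has uncountably many stationary entries
  obtain ⟨n, hn⟩ : ∃ n, ¬ (N ⁻¹' {n}).Countable := by
    by_contra! h
    refine Set.not_countable_univ (α := Ω) ((Set.countable_iUnion h).mono fun ξ _ => ?_)
    exact Set.mem_iUnion.2 ⟨N ξ, rfl⟩
  have hle : #I ≤ #(N ⁻¹' {n}) := by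
    refine hI.trans ?_
    rwa [← le_aleph0_iff_set_countable, ← lt_aleph_one_iff, not_lt] at hn
  obtain ⟨j⟩ := hle
  refine ⟨fun α => if h : ∃ i, α ∈ A n (j i) then h.choose else Classical.arbitrary I,
    fun i => (hN (j i)).mono_of_lt (j i : Ω) fun α hα _ => ?_⟩
  have hNi : N (j i) = n := (j i).2
  have hex : ∃ i, α ∈ A n (j i) := ⟨i, by rwa [hNi] at hα⟩
  rw [hNi] at hα
  rw [Set.mem_preimage, dif_pos hex, Set.mem_singleton_iff]
  have := hex.choose_spec
  exact j.injective (Subtype.ext (he α this.1 hα.1 (this.2.trans hα.2.symm)))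

end IsStationary

/-! ### Coherent ladders -/

/-- A family of sets `E γ ⊆ γ` of which every initial segment is an earlier member of the family
with finitely many points put on top, such that `E γ` vanishes for stationarily many `γ`, and
every set `E δ ∪ F` of this form is, for stationarily many `γ`, an initial segment of a set `E γ`
cofinal in `γ`. -/
structure IsCoherentLadder {Ω : Type u} [LinearOrder Ω] (E : Ω → Set Ω) : Prop where
  lt_of_mem : ∀ γ, ∀ ξ ∈ E γ, ξ < γ
  coherent : ∀ γ β, ∃ δ ≤ β, ∃ F : Finset Ω, (∀ ξ ∈ F, δ ≤ ξ ∧ ξ < β) ∧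
    E γ ∩ Set.Iio β = E δ ∪ F
  stationary_empty : IsStationary {γ | E γ = ∅}
  stationary_extends : ∀ (δ β : Ω) (F : Finset Ω), δ ≤ β → (∀ ξ ∈ F, δ ≤ ξ ∧ ξ < β) →
    IsStationary {γ | E γ ∩ Set.Iio β = E δ ∪ F ∧ ∀ ξ < γ, ∃ η ∈ E γ, ξ ≤ η}

theorem IsCoherentLadder.bot_eq_empty {Ω : Type u} [LinearOrder Ω] [OrderBot Ω] {E : Ω → Set Ω}
    (hE : IsCoherentLadder E) : E ⊥ = ∅ :=
  Set.eq_empty_of_forall_notMem fun ξ hξ => not_lt_bot (hE.lt_of_mem ⊥ ξ hξ)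

/-- The family that at `γ` obeys the label `(δ, F, β)`: it puts the part of `C γ` from `β` on
above `E δ ∪ F`, provided that `E δ ∪ F` is a node of height `β < γ`. Without a label, or with an
inadmissible one, the value is empty. -/
def ladder {Ω : Type u} [LinearOrder Ω] [WellFoundedLT Ω]
    (lab : Ω → Option (Ω × Finset Ω × Ω)) (C : Ω → Set Ω) (γ : Ω) : Set Ω :=
  {x | ∃ δ F β, ∃ _ : lab γ = some (δ, F, β) ∧ δ ≤ β ∧ β < γ ∧ ∀ ξ ∈ F, δ ≤ ξ ∧ ξ < β,
    x ∈ ladder lab C δ ∨ x ∈ F ∨ x ∈ C γ ∧ β ≤ x}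
termination_by wellFounded_lt.wrap γ
decreasing_by
  rename_i h
  exact h.2.1.trans_lt h.2.2.1

section ladder

variable {Ω : Type u} [LinearOrder Ω] [WellFoundedLT Ω]
  {lab : Ω → Option (Ω × Finset Ω × Ω)} {C : Ω → Set Ω} {γ δ β : Ω} {F : Finset Ω}

theorem ladder_eq (h : lab γ = some (δ, F, β)) (hδ : δ ≤ β) (hβ : β < γ)
    (hF : ∀ ξ ∈ F, δ ≤ ξ ∧ ξ < β) :
    ladder lab C γ = ladder lab C δ ∪ F ∪ (C γ ∩ Set.Ici β) := by
  ext x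
  rw [ladder]
  constructor
  · rintro ⟨δ', F', β', ⟨h', -⟩, hx⟩
    rw [h, Option.some_inj, Prod.mk.injEq, Prod.mk.injEq] at h'
    obtain ⟨rfl, rfl, rfl⟩ := h'
    simpa [or_assoc] using hx
  · intro hx
    exact ⟨δ, F, β, ⟨h, hδ, hβ, hF⟩, by simpa [or_assoc] using hx⟩

theorem ladder_eq_empty_or (lab : Ω → Option (Ω × Finset Ω × Ω)) (C : Ω → Set Ω) (γ : Ω) :
    ladder lab C γ = ∅ ∨ ∃ (δ : Ω) (F : Finset Ω) (β : Ω), δ ≤ β ∧ β < γ ∧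
      (∀ ξ ∈ F, δ ≤ ξ ∧ ξ < β) ∧
      ladder lab C γ = ladder lab C δ ∪ F ∪ (C γ ∩ Set.Ici β) := by
  refine (Set.eq_empty_or_nonempty _).imp_right ?_
  rintro ⟨x, hx⟩
  rw [ladder] at hx
  obtain ⟨δ, F, β, ⟨h, hδ, hβ, hF⟩, -⟩ := hx
  exact ⟨δ, F, β, hδ, hβ, hF, ladder_eq h hδ hβ hF⟩

theorem ladder_eq_empty (h : lab γ = none) : ladder lab C γ = ∅ := by
  rw [ladder]
  ext x
  simp [h]

theorem lt_of_mem_ladder (hC : ∀ γ, ∀ ξ ∈ C γ, ξ < γ) (γ : Ω) :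
    ∀ ξ ∈ ladder lab C γ, ξ < γ := by
  induction γ using WellFoundedLT.induction with
  | ind γ ih =>
    intro ξ hξ
    obtain h | ⟨δ, F, β, hδ, hβ, hF, h⟩ := ladder_eq_empty_or lab C γ
    · simp [h] at hξ
    · rw [h] at hξ
      obtain (hξ | hξ) | hξ := hξ
      · exact (ih δ (hδ.trans_lt hβ) ξ hξ).trans (hδ.trans_lt hβ)
      · exact (hF ξ hξ).2.trans hβ
      · exact hC γ ξ hξ.1

end ladder

theorem exists_isCoherentLadder (Ω : Type u) [LinearOrder Ω] [IsOmegaOne Ω] [OrderBot Ω] :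
    ∃ E : Ω → Set Ω, IsCoherentLadder E := by
  classical
  have hcard : #(Option (Ω × Finset Ω × Ω)) ≤ ℵ₁ := by
    have : Infinite Ω := inferInstance
    have hinf : (ℵ₀ : Cardinal.{u}) ≤ ℵ₁ := aleph0_lt_aleph_one.le
    rw [mk_option, mk_prod, mk_prod, mk_finset_of_infinite]
    simp only [lift_id, IsOmegaOne.mk_eq (Ω := Ω), mul_eq_self hinf]
    exact (add_one_eq hinf).le
  obtain ⟨lab, hlab⟩ := IsStationary.exists_fibres (Ω := Ω) hcard
  choose C hCγ hCcof hCfin using IsOmegaOne.exists_cofinal (Ω := Ω)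
  have hlt := lt_of_mem_ladder (lab := lab) hCγ
  refine ⟨ladder lab C, hlt, ?_, ?_, ?_⟩
  · intro γ
    induction γ using WellFoundedLT.induction with
    | ind γ ih =>
      intro β
      obtain hle | hβγ := le_or_gt γ β
      · exact ⟨γ, hle, ∅, by simp, by
          rw [Finset.coe_empty, Set.union_empty, Set.inter_eq_left]
          exact fun ξ hξ => (hlt γ ξ hξ).trans_le hle⟩
      obtain h | ⟨δ, F, β', hδ, hβ', hF, h⟩ := ladder_eq_empty_or lab C γ
      · refine ⟨⊥, bot_le, ∅, by simp, ?_⟩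
        have : ladder lab C ⊥ = ∅ :=
          Set.eq_empty_of_forall_notMem fun ξ hξ => not_lt_bot (hlt ⊥ ξ hξ)
        simp [h, this]
      obtain hδβ | hβδ := le_or_gt δ β
      · refine ⟨δ, hδβ, F.filter (· < β) ∪
          ((hCfin γ β hβγ).toFinset.filter (β' ≤ ·)), ?_, ?_⟩
        · intro ξ hξ
          simp only [Finset.mem_union, Finset.mem_filter, Set.Finite.mem_toFinset] at hξ
          obtain hξ | hξ := hξ
          · exact ⟨(hF ξ hξ.1).1, hξ.2⟩
          · exact ⟨hδ.trans hξ.2, hξ.1.2⟩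
        · have hsub (ξ : Ω) (hξ : ξ ∈ ladder lab C δ) : ξ < β := (hlt δ ξ hξ).trans_le hδβ
          ext ξ
          have := hsub ξ
          simp only [h, Set.mem_inter_iff, Set.mem_union, Finset.mem_coe, Set.mem_Ici,
            Set.mem_Iio, Finset.coe_union, Finset.coe_filter, Set.Finite.mem_toFinset,
            Set.mem_ofPred_eq]
          tauto
      · obtain ⟨δ', hδ', F', hF', h'⟩ := ih δ (hδ.trans_lt hβ') β
        refine ⟨δ', hδ', F', hF', ?_⟩
        rw [← h']
        ext ξ
        have h1 : ξ ∈ F → ¬ ξ < β := fun hξ => (hβδ.le.trans (hF ξ hξ).1).not_gt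
        have h2 : β' ≤ ξ → ¬ ξ < β := fun hξ => (hβδ.le.trans (hδ.trans hξ)).not_gt
        simp only [h, Set.mem_inter_iff, Set.mem_union, Finset.mem_coe, Set.mem_Ici,
          Set.mem_Iio]
        tauto
  · exact (hlab none).mono_of_lt ⊥ fun γ hγ _ => ladder_eq_empty hγ
  · intro δ β F hδ hF
    refine (hlab (some (δ, F, β))).mono_of_lt β fun γ hγ hβ => ?_
    rw [Set.mem_ofPred_eq, ladder_eq hγ hδ hβ hF]
    refine ⟨?_, fun ξ hξ => ?_⟩
    · ext ξ
      have h1 : ξ ∈ F → ξ < β := fun hξ => (hF ξ hξ).2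
      have h2 : ξ ∈ ladder lab C δ → ξ < β := fun hξ => (hlt δ ξ hξ).trans_le hδ
      have h3 : β ≤ ξ → ¬ ξ < β := not_lt.2
      simp only [Set.mem_inter_iff, Set.mem_union, Finset.mem_coe, Set.mem_Ici, Set.mem_Iio]
      tauto
    · obtain ⟨η, hη, hle⟩ := hCcof γ (max ξ β) (max_lt hξ hβ)
      exact ⟨η, .inr ⟨hη, (le_max_right _ _).trans hle⟩, (le_max_left _ _).trans hle⟩

/-! ### The space of a coherent ladder -/

/-- The points are the sets `E γ ∪ F` with `F` finite and above `γ`. Identifying sets with their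
characteristic functions, they are the cofinal branches of a tree of height `ω₁`. -/
def LadderSpace {Ω : Type u} [LinearOrder Ω] (E : Ω → Set Ω) : Type u :=
  {x : Set Ω // ∃ γ, ∃ F : Finset Ω, (∀ ξ ∈ F, γ ≤ ξ) ∧ x = E γ ∪ F}

namespace LadderSpace

variable {Ω : Type u} [LinearOrder Ω] {E : Ω → Set Ω}

/-- The point `E γ ∪ F`. -/
def mk (γ : Ω) (F : Finset Ω) (hF : ∀ ξ ∈ F, γ ≤ ξ) : LadderSpace E :=
  ⟨E γ ∪ F, γ, F, hF, rfl⟩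

theorem val_mk (γ : Ω) (F : Finset Ω) (hF : ∀ ξ ∈ F, γ ≤ ξ) :
    (mk γ F hF : LadderSpace E).1 = E γ ∪ F := rfl

/-- The basic neighbourhood of `x` at height `β`: the points that agree with `x` below `β`. -/
def cyl (x : LadderSpace E) (β : Ω) : Set (LadderSpace E) :=
  {y | y.1 ∩ Set.Iio β = x.1 ∩ Set.Iio β}

theorem mem_cyl {x y : LadderSpace E} {β : Ω} :
    y ∈ cyl x β ↔ y.1 ∩ Set.Iio β = x.1 ∩ Set.Iio β := Iff.rfl

theorem mem_cyl_self (x : LadderSpace E) (β : Ω) : x ∈ cyl x β := rfl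

theorem mem_cyl_iff {x y : LadderSpace E} {β : Ω} :
    y ∈ cyl x β ↔ ∀ ξ < β, ξ ∈ y.1 ↔ ξ ∈ x.1 := by
  simp only [mem_cyl, Set.ext_iff, Set.mem_inter_iff, Set.mem_Iio,
    and_congr_left_iff]

theorem cyl_anti (x : LadderSpace E) {β γ : Ω} (h : β ≤ γ) : cyl x γ ⊆ cyl x β := fun _ hy =>
  mem_cyl_iff.2 fun ξ hξ => mem_cyl_iff.1 hy ξ (hξ.trans_le h)

theorem cyl_eq_of_mem {x y : LadderSpace E} {β : Ω} (h : y ∈ cyl x β) : cyl y β = cyl x β := by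
  ext z
  exact ⟨fun hz => Eq.trans hz h, fun hz => Eq.trans hz (Eq.symm h)⟩

/-- The topology with the basic neighbourhoods `LadderSpace.cyl`. -/
instance [Nonempty Ω] : TopologicalSpace (LadderSpace E) where
  IsOpen U := ∀ x ∈ U, ∃ β, cyl x β ⊆ U
  isOpen_univ _ _ := ⟨Classical.arbitrary Ω, Set.subset_univ _⟩
  isOpen_inter U V hU hV x hx := by
    obtain ⟨β, hβ⟩ := hU x hx.1
    obtain ⟨γ, hγ⟩ := hV x hx.2
    exact ⟨max β γ, Set.subset_inter ((cyl_anti x (le_max_left _ _)).trans hβ)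
      ((cyl_anti x (le_max_right _ _)).trans hγ)⟩
  isOpen_sUnion S hS x := by
    rintro ⟨U, hU, hx⟩
    obtain ⟨β, hβ⟩ := hS U hU x hx
    exact ⟨β, hβ.trans (Set.subset_sUnion_of_mem hU)⟩

section Nonempty

variable [Nonempty Ω]

theorem isOpen_iff {U : Set (LadderSpace E)} : IsOpen U ↔ ∀ x ∈ U, ∃ β, cyl x β ⊆ U := Iff.rfl

theorem isClopen_cyl (x : LadderSpace E) (β : Ω) : IsClopen (cyl x β) := by
  rw [IsClopen, ← isOpen_compl_iff]
  exact ⟨isOpen_iff.2 fun y hy => ⟨β, fun z hz hzx => hy (Eq.trans (Eq.symm hz) hzx)⟩,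
    isOpen_iff.2 fun y hy => ⟨β, (cyl_eq_of_mem hy).subset⟩⟩

theorem isTopologicalBasis_cyl : TopologicalSpace.IsTopologicalBasis
    (Set.range fun p : LadderSpace E × Ω => cyl p.1 p.2) := by
  refine TopologicalSpace.isTopologicalBasis_of_isOpen_of_nhds ?_ fun x U hx hU => ?_
  · rintro _ ⟨p, rfl⟩
    exact (isClopen_cyl _ _).2
  · obtain ⟨β, hβ⟩ := isOpen_iff.1 hU x hx
    exact ⟨_, ⟨(x, β), rfl⟩, mem_cyl_self x β, hβ⟩

end Nonempty

/-- The form of the nodes at height `β` of the tree. -/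
theorem exists_inter_Iio_eq (hE : IsCoherentLadder E) (x : LadderSpace E) (β : Ω) :
    ∃ δ ≤ β, ∃ F : Finset Ω, (∀ ξ ∈ F, δ ≤ ξ ∧ ξ < β) ∧ x.1 ∩ Set.Iio β = E δ ∪ F := by
  classical
  obtain ⟨x, γ, F, hF, rfl⟩ := x
  obtain hγ | hγ := le_or_gt γ β
  · refine ⟨γ, hγ, F.filter (· < β), by simpa using fun ξ hξ h => ⟨hF ξ hξ, h⟩, ?_⟩
    ext ξ
    have : ξ ∈ E γ → ξ < β := fun h => (hE.lt_of_mem γ ξ h).trans_le hγ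
    simp only [Set.mem_inter_iff, Set.mem_union, Finset.mem_coe, Set.mem_Iio,
      Finset.mem_filter]
    tauto
  · obtain ⟨δ, hδ, F', hF', h⟩ := hE.coherent γ β
    refine ⟨δ, hδ, F', hF', ?_⟩
    rw [← h]
    ext ξ
    have : ξ ∈ F → ¬ ξ < β := fun h => (hγ.le.trans (hF ξ h)).not_gt
    simp only [Set.mem_inter_iff, Set.mem_union, Finset.mem_coe, Set.mem_Iio]
    tauto

/-- At a limit height `α`, every node other than `E α` is already a point bounded below `α`. -/
theorem inter_Iio_eq_or_exists_mem_cyl (hE : IsCoherentLadder E) {α : Ω}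
    (hα : ∀ ξ < α, ∃ η < α, ξ < η)
    (x : LadderSpace E) : x.1 ∩ Set.Iio α = E α ∨
      ∃ y : LadderSpace E, (∃ ρ < α, y.1 ⊆ Set.Iio ρ) ∧ x ∈ cyl y α := by
  obtain ⟨δ, hδ, F, hF, h⟩ := exists_inter_Iio_eq hE x α
  obtain rfl | hδ := hδ.eq_or_lt
  · left
    have : F = ∅ := Finset.eq_empty_of_forall_notMem fun ξ hξ =>
      (hF ξ hξ).1.not_gt (hF ξ hξ).2
    simpa [this] using h
  right
  obtain ⟨ρ, hρ, hm⟩ := hα ((insert δ F).max' (Finset.insert_nonempty _ _))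
    ((Finset.max'_lt_iff _ _).2 fun ξ hξ =>
      (Finset.mem_insert.1 hξ).elim (fun e => e ▸ hδ) fun hξ => (hF ξ hξ).2)
  rw [Finset.max'_lt_iff] at hm
  have hsub : E δ ∪ F ⊆ Set.Iio ρ := by
    rintro ξ (hξ | hξ)
    · exact (hE.lt_of_mem δ ξ hξ).trans (hm δ (Finset.mem_insert_self _ _))
    · exact hm ξ (Finset.mem_insert_of_mem hξ)
  refine ⟨mk δ F fun ξ hξ => (hF ξ hξ).1, ⟨ρ, hρ, hsub⟩, ?_⟩
  rw [mem_cyl, h, val_mk, Set.inter_eq_left.2]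
  exact hsub.trans (Set.Iio_subset_Iio hρ.le)

variable [IsOmegaOne Ω]

theorem eq_of_forall_mem_cyl {x y : LadderSpace E} (h : ∀ β, y ∈ cyl x β) : y = x := by
  refine Subtype.ext (Set.ext fun ξ => ?_)
  obtain ⟨β, hβ⟩ := IsOmegaOne.exists_forall_lt (Set.countable_singleton ξ)
  exact mem_cyl_iff.1 (h β) ξ (hβ ξ rfl)

theorem isPSpace [Nonempty Ω] : IsPSpace (LadderSpace E) where
  completelyRegular := by
    have : CompletelyRegularSpace (LadderSpace E) := by
      refine .of_isTopologicalBasis_clopens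
        (TopologicalSpace.IsTopologicalBasis.of_isOpen_of_subset (fun U hU => hU.2)
          isTopologicalBasis_cyl ?_)
      rintro _ ⟨p, rfl⟩
      exact isClopen_cyl _ _
    have : T0Space (LadderSpace E) := by
      refine ⟨fun x y hxy => (eq_of_forall_mem_cyl fun β => ?_).symm⟩
      exact (hxy.mem_open_iff (isClopen_cyl x β).2).1 (mem_cyl_self x β)
    exact {}
  isOpen_of_isGδ s hs := by
    obtain ⟨f, hf, rfl⟩ := isGδ_iff_eq_iInter_nat.1 hs
    refine isOpen_iff.2 fun x hx => ?_
    choose b hb using fun n => isOpen_iff.1 (hf n) x (Set.mem_iInter.1 hx n)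
    obtain ⟨β, hβ⟩ := IsOmegaOne.exists_forall_lt (Set.countable_range b)
    exact ⟨β, Set.subset_iInter fun n => (cyl_anti x (hβ _ ⟨n, rfl⟩).le).trans (hb n)⟩

theorem exists_subset_Iio (hE : IsCoherentLadder E) (x : LadderSpace E) : ∃ β, x.1 ⊆ Set.Iio β := by
  obtain ⟨x, γ, F, hF, rfl⟩ := x
  obtain ⟨β, hβ⟩ := IsOmegaOne.exists_forall_lt (F.countable_toSet.insert γ)
  refine ⟨β, ?_⟩
  rintro ξ (hξ | hξ)
  · exact (hE.lt_of_mem γ ξ hξ).trans (hβ γ (by simp))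
  · exact hβ ξ (.inr hξ)

/-- Only countably many points are bounded by a given height, because each of them is a node at
that height and the levels of the tree are countable. -/
theorem countable_subset_Iio (hE : IsCoherentLadder E) (β : Ω) :
    {x : LadderSpace E | x.1 ⊆ Set.Iio β}.Countable := by
  have hnode : (Set.image2 (fun δ t => E δ ∪ t) (Set.Iic β)
      {t : Set Ω | t.Finite ∧ t ⊆ Set.Iio β}).Countable := by
    refine Set.Countable.image2 ?_ (Set.countable_ofPred_finite_subset
      (IsOmegaOne.countable_Iio β)) _
    rw [← Set.Iio_insert]
    exact (IsOmegaOne.countable_Iio β).insert β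
  refine Set.MapsTo.countable_of_injOn (f := Subtype.val) (fun x hx => ?_)
    Subtype.val_injective.injOn hnode
  obtain ⟨δ, hδ, F, hF, h⟩ := exists_inter_Iio_eq hE x β
  rw [Set.inter_eq_left.2 hx] at h
  exact ⟨δ, hδ, F, ⟨F.finite_toSet, fun ξ hξ => (hF ξ hξ).2⟩, h.symm⟩

/-- If a homeomorphism `h` moves `x`, then it moves a neighbourhood `cyl x β` off itself, and for
stationarily many `α` the set `E α` is a point `p` of `cyl x β`. If `α` is moreover closed under
the data of `h⁻¹`, then `h p` agrees below `α` with a point `y` bounded below `α`, so `p` agrees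
below `α` with `h⁻¹ y`, which is bounded below `α`; but `p` is cofinal in `α`. -/
theorem isRigidSpace (hE : IsCoherentLadder E) : IsRigidSpace (LadderSpace E) := by
  intro h
  refine Homeomorph.ext fun x => ?_
  by_contra hne
  obtain ⟨β, hβ, hxβ⟩ : ∃ β, h '' cyl x β ⊆ (cyl x β)ᶜ ∧ ∃ δ ≤ β, ∃ F : Finset Ω,
      (∀ ξ ∈ F, δ ≤ ξ ∧ ξ < β) ∧ x.1 = E δ ∪ F := by
    obtain ⟨β₁, hβ₁⟩ : ∃ β, h x ∉ cyl x β := by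
      by_contra! hall
      exact hne (eq_of_forall_mem_cyl hall)
    obtain ⟨β₂, hβ₂⟩ := isOpen_iff.1
      ((isClopen_cyl x β₁).compl.2.preimage h.continuous) x hβ₁
    obtain ⟨β₃, hβ₃⟩ := exists_subset_Iio hE x
    have h₁ : β₁ ≤ max β₁ (max β₂ β₃) := le_max_left _ _
    have h₂ : β₂ ≤ max β₁ (max β₂ β₃) := (le_max_left _ _).trans (le_max_right _ _)
    have h₃ : β₃ ≤ max β₁ (max β₂ β₃) := (le_max_right _ _).trans (le_max_right _ _)
    refine ⟨max β₁ (max β₂ β₃), ?_, ?_⟩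
    · rintro _ ⟨y, hy, rfl⟩ hyx
      exact hβ₂ (cyl_anti x h₂ hy) (cyl_anti x h₁ hyx)
    · have := exists_inter_Iio_eq hE x (max β₁ (max β₂ β₃))
      rwa [Set.inter_eq_left.2 (hβ₃.trans (Set.Iio_subset_Iio h₃))] at this
  obtain ⟨δ, hδ, F, hF, hx⟩ := hxβ
  -- `m y ρ` is a height at which continuity of `h⁻¹` at `y` holds for the target height `ρ`,
  -- and `b y` bounds `h⁻¹ y`
  have hmod (y : LadderSpace E) (ρ : Ω) : ∃ m, cyl y m ⊆ h.symm ⁻¹' cyl (h.symm y) ρ :=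
    isOpen_iff.1 ((isClopen_cyl _ ρ).2.preimage h.symm.continuous) y (mem_cyl_self _ _)
  choose m hm using hmod
  choose b hb using fun y => exists_subset_Iio hE (h.symm y)
  obtain ⟨α, ⟨hEα, hcof⟩, hβα, hα, hcl⟩ := (hE.stationary_extends δ β F hδ hF).exists_closed
    (c := fun ρ => (fun y => m y ρ) '' {y | y.1 ⊆ Set.Iio ρ} ∪ b '' {y | y.1 ⊆ Set.Iio ρ})
    (fun ρ => ((countable_subset_Iio hE ρ).image _).union ((countable_subset_Iio hE ρ).image _)) β
  let p : LadderSpace E := mk α ∅ (by simp)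
  have hpE : p.1 = E α := by simp [p, val_mk]
  have hpx : p ∈ cyl x β := by
    rw [mem_cyl, hpE, hEα, ← hx, Set.inter_eq_left.2]
    rw [hx, ← hEα]
    exact Set.inter_subset_right
  obtain hq | ⟨y, ⟨ρ, hρ, hy⟩, hqy⟩ := inter_Iio_eq_or_exists_mem_cyl hE hα (h p)
  · refine hβ ⟨p, hpx, rfl⟩ (cyl_eq_of_mem hpx ▸ cyl_anti p hβα.le ?_)
    rw [mem_cyl, hq, hpE]
    exact (Set.inter_eq_left.2 (hE.lt_of_mem α)).symm
  · have hbα : b y < α := hcl ρ hρ _ (.inr ⟨y, hy, rfl⟩)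
    obtain ⟨η, hη, hbη⟩ := hcof (b y) hbα
    obtain ⟨τ, hτ, hητ⟩ := hα η (hE.lt_of_mem α η hη)
    have hσ : max ρ τ < α := max_lt hρ hτ
    have hmα : m y (max ρ τ) < α :=
      hcl _ hσ _ (.inl ⟨y, hy.trans (Set.Iio_subset_Iio (le_max_left _ _)), rfl⟩)
    have hp : p ∈ cyl (h.symm y) (max ρ τ) := by
      simpa using hm y (max ρ τ) (cyl_anti y hmα.le hqy)
    have := (mem_cyl_iff.1 hp η (hητ.trans_le (le_max_right _ _))).1 (hpE ▸ hη)
    exact hbη.not_gt (hb y this)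

variable [OrderBot Ω]

/-- Given an open cover, there is a limit `α` with `E α = ∅` such that every point bounded below
`α` has its chosen neighbourhood of height below `α`; those countably many neighbourhoods cover
the space. -/
theorem lindelofSpace (hE : IsCoherentLadder E) : LindelofSpace (LadderSpace E) := by
  refine ⟨isLindelof_of_countable_subcover fun {ι} U hU hcov => ?_⟩
  choose i hi using fun x : LadderSpace E => Set.mem_iUnion.1 (hcov (Set.mem_univ x))
  choose b hb using fun x : LadderSpace E => isOpen_iff.1 (hU (i x)) x (hi x)
  obtain ⟨α, hEα, hα₀, hα, hcl⟩ := hE.stationary_empty.exists_closed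
    (fun ρ => (countable_subset_Iio hE ρ).image b) ⊥
  refine ⟨i '' {x | x.1 ⊆ Set.Iio α}, (countable_subset_Iio hE α).image i, fun x _ => ?_⟩
  obtain ⟨y, ⟨ρ, hρ, hy⟩, hxy⟩ :
      ∃ y : LadderSpace E, (∃ ρ < α, y.1 ⊆ Set.Iio ρ) ∧ x ∈ cyl y α := by
    refine (inter_Iio_eq_or_exists_mem_cyl hE hα x).elim (fun h => ?_) id
    have hempty : (mk ⊥ ∅ (by simp) : LadderSpace E).1 = ∅ := by
      simp [val_mk, hE.bot_eq_empty]
    refine ⟨mk ⊥ ∅ (by simp), ⟨⊥, hα₀, hempty ▸ Set.empty_subset _⟩, ?_⟩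
    rw [mem_cyl, h, hEα, hempty, Set.empty_inter]
  exact Set.mem_biUnion ⟨y, hy.trans (Set.Iio_subset_Iio hρ.le), rfl⟩
    (hb y (cyl_anti y (hcl ρ hρ _ ⟨y, hy, rfl⟩).le hxy))

theorem cardinalMk_eq (hE : IsCoherentLadder E) : #(LadderSpace E) = ℵ₁ := by
  have hinf : (ℵ₀ : Cardinal.{u}) ≤ ℵ₁ := aleph0_lt_aleph_one.le
  refine le_antisymm ?_ ?_
  · choose γ F _ h using fun x : LadderSpace E => x.2
    have hinj : Function.Injective fun x => (γ x, F x) := fun x y hxy => by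
      rw [Prod.mk.injEq] at hxy
      exact Subtype.ext (by rw [h x, h y, hxy.1, hxy.2])
    have : Infinite Ω := inferInstance
    simpa [mk_prod, mk_finset_of_infinite, IsOmegaOne.mk_eq (Ω := Ω), mul_eq_self hinf] using
      mk_le_of_injective hinj
  · rw [← IsOmegaOne.mk_eq (Ω := Ω)]
    refine mk_le_of_injective (f := fun ξ => (mk ⊥ {ξ} (by simp) : LadderSpace E)) fun ξ η h => ?_
    simpa [val_mk, hE.bot_eq_empty] using congrArg Subtype.val h

theorem isRigidLindelofPSpaceOmegaOne (hE : IsCoherentLadder E) :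
    IsRigidLindelofPSpaceOmegaOne (LadderSpace E) where
  isPSpace := isPSpace
  lindelof := lindelofSpace hE
  rigid := isRigidSpace hE
  card_eq := cardinalMk_eq hE
  weight_eq := by
    refine le_antisymm ?_ (isPSpace.aleph_one_le_topWeight (cardinalMk_eq hE).ge)
    refine (csInf_le' ⟨_, isTopologicalBasis_cyl, rfl⟩ : topWeight (LadderSpace E) ≤ _).trans
      (mk_range_le.trans ?_)
    simp [mk_prod, cardinalMk_eq hE, IsOmegaOne.mk_eq (Ω := Ω), mul_eq_self aleph0_lt_aleph_one.le]

end LadderSpace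

theorem isOmegaOne_toType_ord_aleph_one : IsOmegaOne (ord ℵ₁ : Ordinal.{u}).ToType where
  wellFoundedLT := inferInstance
  countable_Iio a := by
    rw [← le_aleph0_iff_set_countable, ← lt_aleph_one_iff]
    exact (mk_Iio_lt a (by simp)).trans_eq (mk_ord_toType _)
  mk_eq := mk_ord_toType _

/-- Kunen's theorem. -/
theorem exists_isRigidLindelofPSpaceOmegaOne :
    ∃ (X : Type u) (_ : TopologicalSpace X), IsRigidLindelofPSpaceOmegaOne X := by
  have := isOmegaOne_toType_ord_aleph_one.{u}
  let _ : OrderBot (ord ℵ₁ : Ordinal.{u}).ToType := WellFoundedLT.toOrderBot _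
  obtain ⟨E, hE⟩ := exists_isCoherentLadder (ord ℵ₁ : Ordinal.{u}).ToType
  exact ⟨LadderSpace E, inferInstance, LadderSpace.isRigidLindelofPSpaceOmegaOne hE⟩

/-! ### Continuum many rigid Lindelöf P-spaces -/

theorem mainTheorem10 :
    -- there are continuum many such spaces, no two of them homeomorphic
    (∃ (ι : Type u) (Y : ι → Type u) (_ : ∀ i, TopologicalSpace (Y i)),
      #ι = 𝔠 ∧
      (∀ i, IsRigidLindelofPSpaceOmegaOne (Y i)) ∧
      (∀ i j, i ≠ j → IsEmpty (Y i ≃ₜ Y j))) ∧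
    -- there is such a space `X`, and from every such `X` the family arises as the unions of
    -- subfamilies of a disjoint sequence of clopen pieces
    (∃ (X : Type u) (_ : TopologicalSpace X), IsRigidLindelofPSpaceOmegaOne X) ∧
    (∀ (X : Type u) [TopologicalSpace X], IsRigidLindelofPSpaceOmegaOne X →
      ∃ U : ℕ → Set X,
        (∀ n, IsClopen (U n)) ∧
        (∀ n, (U n).Nonempty) ∧
        (∀ m n, m ≠ n → Disjoint (U m) (U n)) ∧
        (∀ A : Set ℕ, IsClopen (⋃ n ∈ A, U n)) ∧
        (∀ A : Set ℕ, A.Nonempty →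
          IsRigidLindelofPSpaceOmegaOne (⋃ n ∈ A, U n : Set X)) ∧
        (∀ A B : Set ℕ, A ≠ B →
          IsEmpty ((⋃ n ∈ A, U n : Set X) ≃ₜ (⋃ n ∈ B, U n : Set X)))) := by
  refine ⟨?_, exists_isRigidLindelofPSpaceOmegaOne, fun X _ hX => hX.exists_clopen_sequence⟩
  obtain ⟨X, _, hX⟩ := exists_isRigidLindelofPSpaceOmegaOne.{u}
  obtain ⟨U, -, -, -, -, hA, hAB⟩ := hX.exists_clopen_sequence
  -- the sets `{0} ∪ (B + 1)` are continuum many nonempty sets of natural numbers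
  let s : ULift.{u} (Set ℕ) → Set ℕ := fun B => insert 0 (Nat.succ '' B.down)
  have hs : Function.Injective s := fun B C h => by
    refine ULift.ext _ _ (Set.ext fun n => ?_)
    simpa [s] using Set.ext_iff.1 h (n + 1)
  refine ⟨ULift.{u} (Set ℕ), fun B => (⋃ n ∈ s B, U n : Set X), fun _ => inferInstance, ?_,
    fun B => hA _ (Set.insert_nonempty _ _), fun B C hBC => hAB _ _ (hs.ne hBC)⟩
  simp
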